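/- Let $\Gamma$ be a group acting by homeomorphisms on a nonempty compact metrizable space $X$, and let $E(X,\Gamma)$ be its enveloping semigroup, i.e. the closure of the image of $\Gamma$ in $X^X$ with the topology of pointwise convergence (a semigroup under composition). Assume that $(X,\Gamma)$ is tame, i.e. that $E(X,\Gamma)$ is a Fréchet (Fréchet–Urysohn) space. Let $\Gamma$ also act by homeomorphisms on a compact Hausdorff space $Y$ so that $(Y,\Gamma)$ is proximal: for all $y,y'\in Y$ there is a net $\gamma_i\in\Gamma$ such that $\gamma_i y$ and $\gamma_i y'$ converge to the same point. Let $\pi:X\to Y$ be a RIM extension with section $y\mapsto\nu_y$; that is, $\pi$ is a continuous $\Gamma$-equivariant surjection, and $y\mapsto \nu_y$ is a continuous $\Gamma$-equivariant map from $Y$ to the Borel probability measures on $X$ (with the weak$^*$ topology) such that $\pi_*\nu_y=\delta_y$ for all $y\in Y$. An element $p\in E(X,\Gamma)$ acts on $Y$ by $p\,\pi(x)=\pi(px)$. A minimal idempotent is an element $v=v^2$ of $E(X,\Gamma)$ that lies in some minimal left ideal of $E(X,\Gamma)$. For an idempotent $v\in E(X,\Gamma)$ let $C_v\subset \overline{vX}$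 be the set of continuity points of the restriction $v\restriction\overline{vX}:\overline{vX}\to X$. Then: 1. Every $p\in E(X,\Gamma)$ is Borel measurable, and $p\nu_y=\nu_{py}$ (with $p\nu_y$ the push-forward) for every $y\in Y$. In particular, $pX$ is $\nu_{py}$-measurable (i.e. measurable for the completion of $\nu_{py}$) and $\nu_{py}(pX)=1$. 2. For every minimal idempotent $v\in E(X,\Gamma)$ there is a unique $y\in Y$ with $vy=y$. For this $y$ we have $vX\subset\pi^{-1}(y)$, $\nu_y(vX)=1$, $\operatorname{supp}(\nu_y)\subset\overline{vX\cap\pi^{-1}(y)}$ and $vX\cap\pi^{-1}(y)=v\,\pi^{-1}(y)$. 3. For every idempotent $v\in E(X,\Gamma)$ we have $C_v\subset vX$. 4. Suppose that $(X,\Gamma)$ is minimal, and let $Y_{fs}\subset Y$ be the set of continuity points of the map $y\mapsto\operatorname{supp}(\nu_y)$ from $Y$ to the space of closed subsets of $X$ with the Vietoris topology. Then $Y_{fs}$ is a dense $G_\delta$ subset of $Y$, and $\operatorname{supp}(\nu_y)=\pi^{-1}(y)$ for every $y\in Y_{fs}$. For every $y\in Y$ with $\operatorname{supp}(\nu_y)=\pi^{-1}(y)$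 (in particular for every $y\in Y_{fs}$) and every minimal idempotent $v\in E(X,\Gamma)$ with $vy=y$, $C_v$ is a dense $G_\delta$ subset of $\pi^{-1}(y)$, and $vX$ is a residual subset of $\pi^{-1}(y)$. -/

import Mathlib

open Set Filter Topology MeasureTheory

namespace TopDyn

section

variable (Γ : Type*) {X Y : Type*} [Group Γ] [TopologicalSpace X] [MulAction Γ X]
  [TopologicalSpace Y] [MulAction Γ Y]

/-- The enveloping semigroup `E(X, Γ)`: the closure of the image of `Γ` in the product
space `X ^ X` (the semigroup operation is composition of maps). -/
def envelopingSemigroup (X : Type*) [TopologicalSpace X] [MulAction Γ X] : Set (X → X) :=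
  closure (range fun (γ : Γ) (x : X) => γ • x)

/-- The system `(X, Γ)` is tame: its enveloping semigroup, with the topology of pointwise
convergence, is a Fréchet space. -/
def IsTame (X : Type*) [TopologicalSpace X] [MulAction Γ X] : Prop :=
  FrechetUrysohnSpace (envelopingSemigroup Γ X)

/-- The pair `(x, x')` is proximal: along some net in `Γ` (encoded by a filter on `Γ`)
the points `γ x` and `γ x'` converge to a common limit. -/
def IsProximalPair (x x' : X) : Prop :=
  ∃ z : X, ∃ l : Filter Γ, l.NeBot ∧
    Tendsto (fun γ : Γ => γ • x) l (𝓝 z) ∧ Tendsto (fun γ : Γ => γ • x') l (𝓝 z)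

/-- The system `(X, Γ)` is proximal: all pairs are proximal. -/
def IsProximal (X : Type*) [TopologicalSpace X] [MulAction Γ X] : Prop :=
  ∀ x x' : X, IsProximalPair Γ x x'

/-- Homomorphisms (extensions) of dynamical systems: continuous equivariant surjections. -/
structure IsHomomorphism (π : X → Y) : Prop where
  continuous : Continuous π
  surjective : Function.Surjective π
  map_smul : ∀ (γ : Γ) (x : X), π (γ • x) = γ • π x

/-- Left ideals of the semigroup `E(X, Γ)` (non-empty). -/
structure IsLeftIdeal (I : Set (X → X)) : Prop where
  nonempty : I.Nonempty
  subset : I ⊆ envelopingSemigroup Γ X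
  comp_mem : ∀ p ∈ envelopingSemigroup Γ X, ∀ q ∈ I, p ∘ q ∈ I

/-- Minimal left ideals of `E(X, Γ)`. -/
def IsMinimalLeftIdeal (I : Set (X → X)) : Prop :=
  IsLeftIdeal Γ I ∧ ∀ J : Set (X → X), IsLeftIdeal Γ J → J ⊆ I → J = I

/-- Idempotents `v = v ^ 2` of `E(X, Γ)`. -/
def IsIdempotent (v : X → X) : Prop :=
  v ∈ envelopingSemigroup Γ X ∧ v ∘ v = v

/-- Minimal idempotents of `E(X, Γ)`: those that lie in some minimal left ideal. -/
def IsMinimalIdempotent (v : X → X) : Prop :=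
  IsIdempotent Γ v ∧ ∃ I : Set (X → X), IsMinimalLeftIdeal Γ I ∧ v ∈ I

variable {Γ}

/-- The action on the factor `Y` of an element `p` of `E(X, Γ)`. It is the map `q : Y → Y`
with `q ∘ π = π ∘ p` (see `IsHomomorphism.factorMap_apply`), and it lies in `E(Y, Γ)`
(see `IsHomomorphism.factorMap_mem`). -/
noncomputable def IsHomomorphism.factorMap {π : X → Y} (hπ : IsHomomorphism Γ π)
    (p : X → X) : Y → Y :=
  fun y => π (p (Function.surjInv hπ.surjective y))

theorem IsHomomorphism.factorMap_apply [T2Space Y] {π : X → Y} (hπ : IsHomomorphism Γ π)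
    {p : X → X} (hp : p ∈ envelopingSemigroup Γ X) (x : X) :
    hπ.factorMap p (π x) = π (p x) := by
  have hcl : IsClosed {q : X → X |
      π (q (Function.surjInv hπ.surjective (π x))) = π (q x)} :=
    isClosed_eq (hπ.continuous.comp (continuous_apply _)) (hπ.continuous.comp (continuous_apply _))
  refine closure_minimal ?_ hcl hp
  rintro _ ⟨γ, rfl⟩
  simp [hπ.map_smul, Function.surjInv_eq]

theorem IsHomomorphism.factorMap_mem {π : X → Y} (hπ : IsHomomorphism Γ π)
    {p : X → X} (hp : p ∈ envelopingSemigroup Γ X) :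
    hπ.factorMap p ∈ envelopingSemigroup Γ Y := by
  have hc : Continuous hπ.factorMap :=
    continuous_pi fun y => hπ.continuous.comp (continuous_apply _)
  refine map_mem_closure hc hp ?_
  rintro _ ⟨γ, rfl⟩
  exact ⟨γ, by funext y; simp [IsHomomorphism.factorMap, hπ.map_smul, Function.surjInv_eq]⟩

/-- The set `C_A(p)` of continuity points of the restricted map `p ↾ A : A → X`. -/
def contPoints (A : Set X) (p : X → X) : Set X :=
  {x ∈ A | ContinuousWithinAt p A x}

/-- `C_v`: the continuity points of the restriction of `v` to the closure of `v X`. -/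
def idemContPoints (v : X → X) : Set X :=
  contPoints (closure (range v)) v

variable (Γ)

/-- `ν` is a section of the extension `π : X → Y`, witnessing that `π` has a relatively
invariant measure: `y ↦ ν y` is a continuous `Γ`-equivariant map from `Y` to the Borel
probability measures on `X` (with the weak topology), and `ν y` projects to the point mass
at `y`. -/
structure IsRIMSection [MeasurableSpace X] [BorelSpace X] [MeasurableSpace Y] [BorelSpace Y]
    (π : X → Y) (ν : Y → ProbabilityMeasure X) : Prop where
  continuous : Continuous ν
  equivariant : ∀ (γ : Γ) (y : Y),
    (ν (γ • y) : Measure X) = (ν y : Measure X).map (fun x => γ • x)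
  map_eq_dirac : ∀ y : Y, (ν y : Measure X).map π = Measure.dirac y

end

/-- `Y_fs`: the set of continuity points of `y ↦ supp (ν y)`, a map from `Y` to the closed
subsets of `X` with the Vietoris topology. -/
def fullSupportPoints {X Y : Type*} [TopologicalSpace X] [TopologicalSpace Y]
    [MeasurableSpace X] (ν : Y → ProbabilityMeasure X) : Set Y :=
  {y | @ContinuousAt Y (Set X) _ (TopologicalSpace.vietoris X)
    (fun z => (ν z : Measure X).support) y}

end TopDyn

/-! Tameness makes every `p` in `E(X, Γ)` the pointwise limit of a sequence from `Γ`
(`IsTame.exists_seq_tendsto`), so `p` is of Baire class one. Hence `p` is Borel, dominated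
convergence gives `pν_y = ν_{py}`, Egorov's theorem makes the range of `p` conull, and on a closed
set `p` is continuous at a dense `Gδ` of points.

Proximality of `Y` forces a minimal idempotent `v` to act on `Y` as a constant
(`IsMinimalIdempotent.factorMap_eq`), so `vX` is a conull subset of one fibre. Since `v` fixes `vX`
pointwise, continuity points of `v` on the closure of `vX` are fixed too.

In the minimal case, Fort's theorem applied to the lower semicontinuous map `y ↦ supp ν_y` gives
`Y_fs`. When the support is the whole fibre, `vX` is dense in it, and `C_v` is the set of continuity
points of `v` on the fibre. -/

namespace TopDyn

/-! ### Pointwise limits of continuous maps -/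

section General

/-- The continuity points of a pointwise limit of continuous maps from a Baire space to a
metrizable space are dense. -/
theorem dense_setOf_continuousAt_of_tendsto {Z W : Type*} [TopologicalSpace Z] [BaireSpace Z]
    [TopologicalSpace W] [TopologicalSpace.MetrizableSpace W] {f : ℕ → Z → W} {g : Z → W}
    (hf : ∀ n, Continuous (f n)) (h : ∀ z, Tendsto (fun n => f n z) atTop (𝓝 (g z))) :
    Dense {z | ContinuousAt g z} := by
  let := TopologicalSpace.metrizableSpaceMetric W
  let A : ℕ → ℕ → Set Z := fun k N =>
    {z | ∀ m ≥ N, dist (f N z) (f m z) ≤ 1 / ((k : ℝ) + 1)}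
  have hA : ∀ k N, IsClosed (A k N) := fun k N => by
    simp only [A, ofPred_forall]
    exact isClosed_biInter fun m _ => isClosed_le ((hf N).dist (hf m)) continuous_const
  have hcover : ∀ k, ⋃ N, A k N = univ := fun k => by
    refine eq_univ_of_forall fun z => ?_
    have hk : (0 : ℝ) < 1 / ((k : ℝ) + 1) := Nat.one_div_pos_of_nat
    obtain ⟨N, hN⟩ := Metric.cauchySeq_iff'.1 (h z).cauchySeq _ hk
    exact mem_iUnion.2 ⟨N, fun m hm => by rw [dist_comm]; exact (hN m hm).le⟩
  -- Baire category: on the interior of `A k N` the limit is uniformly within `1 / (k + 1)` of the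
  -- continuous map `f N`.
  have hd : Dense (⋂ k, ⋃ N, interior (A k N)) :=
    dense_iInter_of_isOpen (fun k => isOpen_iUnion fun N => isOpen_interior)
      fun k => dense_iUnion_interior_of_closed (hA k) (hcover k)
  refine hd.mono fun z hz => ?_
  rw [mem_ofPred_eq, Metric.continuousAt_iff']
  intro ε hε
  obtain ⟨k, hk⟩ := exists_nat_one_div_lt (by positivity : 0 < ε / 3)
  obtain ⟨N, hN⟩ := mem_iUnion.1 (mem_iInter.1 hz k)
  have hlim : ∀ w ∈ A k N, dist (f N w) (g w) ≤ 1 / ((k : ℝ) + 1) := fun w hw =>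
    le_of_tendsto (tendsto_const_nhds.dist (h w)) (eventually_atTop.2 ⟨N, hw⟩)
  filter_upwards [isOpen_interior.mem_nhds hN,
    Metric.continuousAt_iff'.1 (hf N).continuousAt (ε / 3) (by positivity)] with w hw hw'
  have h1 := hlim w (interior_subset hw)
  have h2 := hlim z (interior_subset hN)
  have h3 := dist_triangle4 (g w) (f N w) (f N z) (g z)
  rw [dist_comm (g w) (f N w)] at h3
  linarith

/-- A pointwise limit of continuous maps is continuous on compact sets of almost full measure. -/
theorem exists_isCompact_continuousOn_of_tendsto {Z W : Type*} [TopologicalSpace Z]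
    [MeasurableSpace Z] [BorelSpace Z] [T2Space Z] [TopologicalSpace W]
    [TopologicalSpace.MetrizableSpace W] [SecondCountableTopology W] [MeasurableSpace W]
    [BorelSpace W] (μ : Measure Z) [IsFiniteMeasure μ] [μ.InnerRegularCompactLTTop]
    {f : ℕ → Z → W} {g : Z → W}
    (hf : ∀ n, Continuous (f n)) (h : ∀ z, Tendsto (fun n => f n z) atTop (𝓝 (g z)))
    {ε : ℝ} (hε : 0 < ε) :
    ∃ K : Set Z, IsCompact K ∧ ContinuousOn g K ∧ μ Kᶜ ≤ ENNReal.ofReal ε := by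
  let := TopologicalSpace.metrizableSpaceMetric W
  have hg : Measurable g :=
    measurable_of_tendsto_metrizable (fun n => (hf n).measurable) (tendsto_pi_nhds.2 h)
  -- Egorov's theorem; half of `ε` is kept for the compact approximation from inside.
  obtain ⟨t, ht, htμ, hu⟩ := tendstoUniformlyOn_of_ae_tendsto' (μ := μ)
    (fun n => (hf n).measurable.stronglyMeasurable) hg.stronglyMeasurable
    (Eventually.of_forall h) (half_pos hε)
  obtain ⟨K, hKt, hK, hKμ⟩ := ht.compl.exists_isCompact_sdiff_lt (measure_ne_top μ _)
    (ε := ENNReal.ofReal (ε / 2)) (by simpa using hε)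
  refine ⟨K, hK, (hu.continuousOn (Frequently.of_forall fun n => (hf n).continuousOn)).mono hKt, ?_⟩
  calc μ Kᶜ ≤ μ (t ∪ (tᶜ \ K)) := measure_mono fun x hx => by
        by_cases hxt : x ∈ t
        · exact Or.inl hxt
        · exact Or.inr ⟨hxt, hx⟩
    _ ≤ ENNReal.ofReal (ε / 2) + ENNReal.ofReal (ε / 2) :=
        (measure_union_le _ _).trans (add_le_add htμ hKμ.le)
    _ = ENNReal.ofReal ε := by
        rw [← ENNReal.ofReal_add (half_pos hε).le (half_pos hε).le, add_halves]

/-- The range of a pointwise limit `g` of continuous maps contains a Borel set that is conull for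
the push-forward measure under `g`. -/
theorem exists_measurableSet_subset_range_of_tendsto {Z W : Type*} [TopologicalSpace Z]
    [MeasurableSpace Z] [BorelSpace Z] [T2Space Z] [TopologicalSpace W]
    [TopologicalSpace.MetrizableSpace W] [SecondCountableTopology W] [MeasurableSpace W]
    [BorelSpace W] (μ : Measure Z) [IsFiniteMeasure μ] [μ.InnerRegularCompactLTTop]
    {f : ℕ → Z → W} {g : Z → W}
    (hf : ∀ n, Continuous (f n)) (h : ∀ z, Tendsto (fun n => f n z) atTop (𝓝 (g z))) :
    ∃ A ⊆ range g, MeasurableSet A ∧ μ.map g Aᶜ = 0 := by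
  have hg : Measurable g :=
    measurable_of_tendsto_metrizable (fun n => (hf n).measurable) (tendsto_pi_nhds.2 h)
  choose K hK hKg hKμ using fun k : ℕ =>
    exists_isCompact_continuousOn_of_tendsto μ hf h (Nat.one_div_pos_of_nat (α := ℝ) (n := k))
  have hA : MeasurableSet (⋃ k, g '' K k) :=
    MeasurableSet.iUnion fun k => ((hK k).image_of_continuousOn (hKg k)).measurableSet
  refine ⟨⋃ k, g '' K k, iUnion_subset fun k => image_subset_range _ _, hA, ?_⟩
  rw [Measure.map_apply hg hA.compl]
  have hle : ∀ k : ℕ, μ (g ⁻¹' (⋃ k, g '' K k)ᶜ) ≤ ENNReal.ofReal (1 / ((k : ℝ) + 1)) := fun k =>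
    le_trans (measure_mono fun x (hx : g x ∉ ⋃ k, g '' K k) hxK =>
      hx (mem_iUnion.2 ⟨k, mem_image_of_mem g hxK⟩)) (hKμ k)
  have hlim : Tendsto (fun k : ℕ => ENNReal.ofReal (1 / ((k : ℝ) + 1))) atTop (𝓝 0) := by
    simpa using ENNReal.tendsto_ofReal tendsto_one_div_add_atTop_nhds_zero_nat
  exact le_antisymm (ge_of_tendsto' hlim hle) bot_le

/-- The continuity points, relative to a closed set `A`, of a pointwise limit of continuous maps
on a compact metrizable space form a dense `Gδ` subset of `A`. -/
theorem dense_isGδ_contPoints {X : Type*} [TopologicalSpace X] [CompactSpace X]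
    [TopologicalSpace.MetrizableSpace X] {A : Set X} (hA : IsClosed A) {f : ℕ → X → X}
    {p : X → X} (hf : ∀ n, Continuous (f n))
    (h : ∀ x, Tendsto (fun n => f n x) atTop (𝓝 (p x))) :
    Dense ((↑) ⁻¹' contPoints A p : Set A) ∧ IsGδ ((↑) ⁻¹' contPoints A p : Set A) := by
  let := TopologicalSpace.metrizableSpaceMetric X
  have heq : ((↑) ⁻¹' contPoints A p : Set A) = {x | ContinuousAt (A.domRestrict p) x} := by
    ext ⟨x, hx⟩
    simp [contPoints, continuousWithinAt_iff_continuousAt_domRestrict p hx]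
  have : CompactSpace A := isCompact_iff_compactSpace.1 hA.isCompact
  rw [heq]
  exact ⟨dense_setOf_continuousAt_of_tendsto (f := fun n => A.domRestrict (f n))
    (fun n => (hf n).comp continuous_subtype_val) fun x => h x, IsGδ.setOfPred_continuousAt _⟩

end General

/-! ### Semicontinuous set-valued maps and supports -/

section Semicontinuity

variable {X Y : Type*} [TopologicalSpace X] [TopologicalSpace Y]

/-- A lower semicontinuous set-valued map is continuous for the Vietoris topology at the points
where it is upper semicontinuous. -/
theorem continuousAt_vietoris_iff {S : Y → Set X}
    (hS : ∀ U : Set X, IsOpen U → IsOpen {y | (S y ∩ U).Nonempty}) (y : Y) :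
    @ContinuousAt Y (Set X) _ (TopologicalSpace.vietoris X) S y ↔
      ∀ U : Set X, IsOpen U → S y ⊆ U → ∀ᶠ z in 𝓝 y, S z ⊆ U := by
  let := TopologicalSpace.vietoris X
  constructor
  · intro h U hU hyU
    exact h (hU.powerset_vietoris.mem_nhds hyU)
  · intro h
    refine TopologicalSpace.tendsto_nhds_generateFrom_iff.2 ?_
    rintro _ (⟨U, hU, rfl⟩ | ⟨U, hU, rfl⟩) hy
    · exact h U hU hy
    · exact (hS U hU).mem_nhds hy

/-- Fort's theorem: a lower semicontinuous map from a Baire space to the closed subsets of a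
compact metrizable space is continuous at the points of a dense `Gδ` set. -/
theorem dense_isGδ_continuousAt_vietoris [CompactSpace X] [TopologicalSpace.MetrizableSpace X]
    [BaireSpace Y] {S : Y → Set X} (hcl : ∀ y, IsClosed (S y))
    (hS : ∀ U : Set X, IsOpen U → IsOpen {y | (S y ∩ U).Nonempty}) :
    Dense {y | @ContinuousAt Y (Set X) _ (TopologicalSpace.vietoris X) S y} ∧
      IsGδ {y | @ContinuousAt Y (Set X) _ (TopologicalSpace.vietoris X) S y} := by
  let := TopologicalSpace.metrizableSpaceMetric X
  -- Finite unions of basic open sets form a countable family that interpolates between a compact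
  -- set and its open neighbourhoods.
  let B := TopologicalSpace.countableBasis X
  have hBb : TopologicalSpace.IsTopologicalBasis B := TopologicalSpace.isBasis_countableBasis X
  let T : Set (Set (Set X)) := {s | s.Finite ∧ s ⊆ B}
  have hT : T.Countable := countable_ofPred_finite_subset (TopologicalSpace.countable_countableBasis X)
  have hTopen : ∀ s ∈ T, IsOpen (⋃₀ s) := fun s hs => isOpen_sUnion fun u hu =>
    hBb.isOpen (hs.2 hu)
  have hinterp : ∀ F U : Set X, IsClosed F → IsOpen U → F ⊆ U →
      ∃ s ∈ T, F ⊆ ⋃₀ s ∧ closure (⋃₀ s) ⊆ U := by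
    intro F U hF hU hFU
    obtain ⟨V, hV, hFV, hVU⟩ := normal_exists_closure_subset hF hU hFU
    choose u hu hxu huV using fun x : F => hBb.exists_subset_of_mem_open (hFV x.2) hV
    obtain ⟨t, ht⟩ := hF.isCompact.elim_finite_subcover u (fun x => hBb.isOpen (hu x))
      fun x hx => mem_iUnion.2 ⟨⟨x, hx⟩, hxu _⟩
    refine ⟨u '' t, ⟨t.finite_toSet.image u, image_subset_iff.2 fun x _ => hu x⟩, ?_, ?_⟩
    · simpa [sUnion_image] using ht
    · refine (closure_mono (sUnion_subset ?_)).trans hVU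
      rintro _ ⟨x, _, rfl⟩
      exact huV x
  let I : Set (Set (Set X) × Set (Set X)) := {q ∈ T ×ˢ T | closure (⋃₀ q.1) ⊆ ⋃₀ q.2}
  have hI : I.Countable := (hT.prod hT).mono fun q hq => hq.1
  let O : Set (Set X) × Set (Set X) → Set Y := fun q =>
    {y | (S y ∩ (closure (⋃₀ q.1))ᶜ).Nonempty} ∪ interior {y | S y ⊆ ⋃₀ q.2}
  have hOopen : ∀ q ∈ I, IsOpen (O q) := fun q _ =>
    (hS _ isClosed_closure.isOpen_compl).union isOpen_interior
  have hOdense : ∀ q ∈ I, Dense (O q) := by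
    intro q hq
    rw [dense_iff_inter_open]
    rintro W hW ⟨y, hy⟩
    -- If no value over `W` leaves the closure of `⋃₀ q.1`, then all of them lie in `⋃₀ q.2`, so `W`
    -- is in the interior part.
    by_cases hne : (W ∩ {y | (S y ∩ (closure (⋃₀ q.1))ᶜ).Nonempty}).Nonempty
    · exact hne.mono (inter_subset_inter_right _ subset_union_left)
    · refine ⟨y, hy, Or.inr (mem_interior.2 ⟨W, fun z hz => ?_, hW, hy⟩)⟩
      intro x hx
      by_contra hxU
      exact hne ⟨z, hz, x, hx, fun hxc => hxU (hq.2 hxc)⟩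
  have heq : {y | @ContinuousAt Y (Set X) _ (TopologicalSpace.vietoris X) S y} =
      ⋂ q ∈ I, O q := by
    ext y
    rw [mem_ofPred_eq, continuousAt_vietoris_iff hS, mem_iInter₂]
    constructor
    · intro h q hq
      by_cases hy : (S y ∩ (closure (⋃₀ q.1))ᶜ).Nonempty
      · exact Or.inl hy
      · have hsub : S y ⊆ ⋃₀ q.2 := fun x hx => hq.2 (by
          by_contra hxc
          exact hy ⟨x, hx, hxc⟩)
        exact Or.inr (mem_interior_iff_mem_nhds.2 (h _ (hTopen _ hq.1.2) hsub))
    · intro h U hU hyU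
      obtain ⟨s, hs, hys, hsU⟩ := hinterp _ _ (hcl y) hU hyU
      obtain ⟨r, hr, hyr, hrs⟩ := hinterp _ _ (hcl y) (hTopen s hs) hys
      rcases h (r, s) ⟨⟨hr, hs⟩, hrs⟩ with ⟨x, hx, hxr⟩ | hint
      · exact absurd (subset_closure (hyr hx)) hxr
      · filter_upwards [mem_interior_iff_mem_nhds.1 hint] with z hz
        exact hz.trans (subset_closure.trans hsU)
  rw [heq]
  exact ⟨dense_biInter_of_isOpen hOopen hI hOdense,
    IsGδ.biInter hI fun q hq => (hOopen q hq).isGδ⟩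

/-- The support of a probability measure is a lower semicontinuous function of the measure. -/
theorem isOpen_setOf_support_inter_nonempty [HasOuterApproxClosed X]
    [HereditarilyLindelofSpace X] [MeasurableSpace X] [OpensMeasurableSpace X]
    {ν : Y → ProbabilityMeasure X} (hν : Continuous ν) {U : Set X} (hU : IsOpen U) :
    IsOpen {y | ((ν y : Measure X).support ∩ U).Nonempty} := by
  have heq : ∀ y, ((ν y : Measure X).support ∩ U).Nonempty ↔ 0 < (ν y : Measure X) U := by
    refine fun y => ⟨?_, fun h => ?_⟩
    · rintro ⟨x, hx, hxU⟩
      exact (Measure.mem_support_iff_forall x).1 hx U (hU.mem_nhds hxU)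
    · rw [inter_comm]
      exact Measure.nonempty_inter_support_of_pos h
  simp only [heq]
  refine isOpen_iff_mem_nhds.2 fun y hy => ?_
  exact eventually_lt_of_lt_liminf
    (lt_of_lt_of_le hy (ProbabilityMeasure.le_liminf_measure_open_of_tendsto (hν.tendsto y) hU))

end Semicontinuity

/-! ### The enveloping semigroup and its idempotents -/

section Enveloping

variable {Γ X Y : Type*} [Group Γ] [TopologicalSpace X] [MulAction Γ X]
  [TopologicalSpace Y] [MulAction Γ Y]

/-- Right composition with any `q` is continuous, but left composition only with a continuous map;
so the closure is taken in `q` first, for `γ ∈ Γ`, and then in `p`. -/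
theorem comp_mem_envelopingSemigroup [ContinuousConstSMul Γ X] {p q : X → X}
    (hp : p ∈ envelopingSemigroup Γ X) (hq : q ∈ envelopingSemigroup Γ X) :
    p ∘ q ∈ envelopingSemigroup Γ X := by
  have hsmul : ∀ γ : Γ, (fun x : X => γ • x) ∘ q ∈ envelopingSemigroup Γ X := by
    intro γ
    have hc : Continuous fun r : X → X => (fun x : X => γ • x) ∘ r :=
      continuous_pi fun x => (continuous_apply x).const_smul γ
    refine map_mem_closure hc hq ?_
    rintro _ ⟨δ, rfl⟩
    exact ⟨γ * δ, by funext x; simp [mul_smul]⟩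
  have hc : Continuous fun r : X → X => r ∘ q := continuous_pi fun x => continuous_apply (q x)
  have := map_mem_closure (t := envelopingSemigroup Γ X) hc hp (by
    rintro _ ⟨γ, rfl⟩
    exact hsmul γ)
  rwa [envelopingSemigroup, closure_closure] at this

theorem IsTame.exists_seq_tendsto (h : IsTame Γ X) {p : X → X}
    (hp : p ∈ envelopingSemigroup Γ X) :
    ∃ γ : ℕ → Γ, ∀ x, Tendsto (fun n => γ n • x) atTop (𝓝 (p x)) := by
  have : FrechetUrysohnSpace (envelopingSemigroup Γ X) := h
  let s : Set (envelopingSemigroup Γ X) := {q | (q : X → X) ∈ range fun (γ : Γ) (x : X) => γ • x}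
  have hps : (⟨p, hp⟩ : envelopingSemigroup Γ X) ∈ closure s := by
    rw [closure_subtype]
    refine closure_mono ?_ hp
    intro q hq
    exact ⟨⟨q, subset_closure hq⟩, hq, rfl⟩
  obtain ⟨u, hu, hlim⟩ := mem_closure_iff_seq_limit.1 hps
  choose γ hγ using hu
  refine ⟨γ, fun x => ?_⟩
  have := tendsto_pi_nhds.1 ((continuous_subtype_val.tendsto _).comp hlim) x
  refine this.congr fun n => ?_
  exact (congrFun (hγ n) x).symm

theorem IsProximalPair.exists_factorMap_eq [CompactSpace X] [T2Space Y] {π : X → Y}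
    (hπ : IsHomomorphism Γ π) {y y' : Y} (h : IsProximalPair Γ y y') :
    ∃ q ∈ envelopingSemigroup Γ X, hπ.factorMap q y = hπ.factorMap q y' := by
  obtain ⟨z, l, hl, hy, hy'⟩ := h
  let F : Γ → X → X := fun γ x => γ • x
  -- An ultrafilter refining `l` converges in the compact space `X → X` and keeps the two limits in
  -- `Y`.
  obtain ⟨q, -, hq⟩ := isCompact_univ.ultrafilter_le_nhds ((Ultrafilter.of l).map F) (by simp)
  have hq' : Tendsto F (Ultrafilter.of l) (𝓝 q) := hq
  refine ⟨q, mem_closure_of_tendsto hq' (Eventually.of_forall fun γ => ⟨γ, rfl⟩), ?_⟩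
  have key : ∀ w : Y, Tendsto (fun γ : Γ => γ • w) l (𝓝 z) → hπ.factorMap q w = z := by
    intro w hw
    obtain ⟨x, rfl⟩ := hπ.surjective w
    refine tendsto_nhds_unique ?_ (hw.mono_left (Ultrafilter.of_le l))
    have h2 := (hπ.continuous.tendsto _).comp
      (tendsto_pi_nhds.1 hq' (Function.surjInv hπ.surjective (π x)))
    refine h2.congr fun γ => ?_
    simp [F, hπ.map_smul, Function.surjInv_eq]
  rw [key y hy, key y' hy']

theorem IsHomomorphism.factorMap_comp [T2Space Y] {π : X → Y} (hπ : IsHomomorphism Γ π)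
    {p : X → X} (hp : p ∈ envelopingSemigroup Γ X) (q : X → X) :
    hπ.factorMap (p ∘ q) = hπ.factorMap p ∘ hπ.factorMap q := by
  funext y
  exact (hπ.factorMap_apply hp _).symm

/-- A minimal idempotent collapses a proximal factor to a point. -/
theorem IsMinimalIdempotent.factorMap_eq [CompactSpace X] [ContinuousConstSMul Γ X] [T2Space Y]
    {π : X → Y} (hπ : IsHomomorphism Γ π) (hprox : IsProximal Γ Y) {v : X → X}
    (hv : IsMinimalIdempotent Γ v) (y y' : Y) : hπ.factorMap v y = hπ.factorMap v y' := by
  obtain ⟨⟨hvE, -⟩, I, ⟨hI, hmin⟩, hvI⟩ := hv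
  obtain ⟨q, hq, hqy⟩ := (hprox (hπ.factorMap v y) (hπ.factorMap v y')).exists_factorMap_eq hπ
  have hqv : q ∘ v ∈ I := hI.comp_mem q hq v hvI
  -- By minimality the left ideal generated by `q ∘ v` is `I`, so `v = r ∘ q ∘ v` for some `r`, and
  -- `q` merges the images of `y` and `y'`.
  let J : Set (X → X) := (fun r => r ∘ (q ∘ v)) '' envelopingSemigroup Γ X
  have hJI : J ⊆ I := by
    rintro _ ⟨r, hr, rfl⟩
    exact hI.comp_mem r hr _ hqv
  have hJ : IsLeftIdeal Γ J := by
    refine ⟨⟨_, v, hvE, rfl⟩, hJI.trans hI.subset, ?_⟩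
    rintro r hr _ ⟨s, hs, rfl⟩
    exact ⟨r ∘ s, comp_mem_envelopingSemigroup hr hs, rfl⟩
  obtain ⟨r, hr, hrv⟩ : v ∈ J := by rw [hmin J hJ hJI]; exact hvI
  have hfac : hπ.factorMap v = hπ.factorMap r ∘ hπ.factorMap q ∘ hπ.factorMap v := by
    conv_lhs => rw [← hrv]
    rw [hπ.factorMap_comp hr, hπ.factorMap_comp hq]
  rw [hfac]
  simp [hqy]

theorem idemContPoints_subset_range [T2Space X] {v : X → X} (hv : v ∘ v = v) :
    idemContPoints v ⊆ range v := by
  rintro x ⟨hx, hcont⟩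
  have := mem_closure_iff_nhdsWithin_neBot.1 hx
  have h1 : Tendsto v (𝓝[range v] x) (𝓝 (v x)) := hcont.mono subset_closure
  have h2 : Tendsto v (𝓝[range v] x) (𝓝 x) := by
    refine (tendsto_nhdsWithin_of_tendsto_nhds tendsto_id).congr' ?_
    filter_upwards [self_mem_nhdsWithin]
    rintro _ ⟨z, rfl⟩
    exact (congrFun hv z).symm
  exact ⟨x, tendsto_nhds_unique h1 h2⟩

end Enveloping

/-! ### Push-forwards and supports of the section measures -/

section Rim

variable {Γ X Y : Type*} [Group Γ]
  [TopologicalSpace X] [CompactSpace X] [TopologicalSpace.MetrizableSpace X]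
  [MeasurableSpace X] [BorelSpace X] [MulAction Γ X] [ContinuousConstSMul Γ X]
  [TopologicalSpace Y] [T2Space Y]
  [MeasurableSpace Y] [BorelSpace Y] [MulAction Γ Y]
  {π : X → Y} {ν : Y → ProbabilityMeasure X}

omit [CompactSpace X] in
theorem IsTame.measurable (htame : IsTame Γ X) {p : X → X} (hp : p ∈ envelopingSemigroup Γ X) :
    Measurable p := by
  obtain ⟨γ, hγ⟩ := htame.exists_seq_tendsto hp
  exact measurable_of_tendsto_metrizable (fun n => (continuous_const_smul (γ n)).measurable)
    (tendsto_pi_nhds.2 hγ)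

omit [CompactSpace X] in
theorem IsRIMSection.map_eq (htame : IsTame Γ X) (hπ : IsHomomorphism Γ π)
    (hν : IsRIMSection Γ π ν) {p : X → X} (hp : p ∈ envelopingSemigroup Γ X) (y : Y) :
    (ν y : Measure X).map p = (ν (hπ.factorMap p y) : Measure X) := by
  have hpm := htame.measurable hp
  obtain ⟨γ, hγ⟩ := htame.exists_seq_tendsto hp
  have hy : Tendsto (fun n => γ n • y) atTop (𝓝 (hπ.factorMap p y)) := by
    obtain ⟨x, rfl⟩ := hπ.surjective y
    rw [hπ.factorMap_apply hp]
    exact ((hπ.continuous.tendsto _).comp (hγ x)).congr fun n => hπ.map_smul _ _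
  have hlim := ProbabilityMeasure.tendsto_iff_forall_integral_tendsto.1
    ((hν.continuous.tendsto _).comp hy)
  have : IsProbabilityMeasure ((ν y : Measure X).map p) :=
    Measure.isProbabilityMeasure_map hpm.aemeasurable
  refine ext_of_forall_integral_eq_of_IsFiniteMeasure fun g => ?_
  refine tendsto_nhds_unique ?_ (hlim g)
  have hint : ∀ n, ∫ x, g x ∂(ν (γ n • y) : Measure X) = ∫ x, g (γ n • x) ∂(ν y : Measure X) := by
    intro n
    rw [hν.equivariant, integral_map (continuous_const_smul (γ n)).measurable.aemeasurable
      g.continuous.measurable.aestronglyMeasurable]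
  simp only [Function.comp_apply, hint]
  rw [integral_map hpm.aemeasurable g.continuous.measurable.aestronglyMeasurable]
  refine tendsto_integral_of_dominated_convergence (fun _ => ‖g‖)
    (fun n => (g.continuous.comp (continuous_const_smul (γ n))).measurable.aestronglyMeasurable)
    (integrable_const _) (fun n => Eventually.of_forall fun x => g.norm_coe_le_norm _)
    (Eventually.of_forall fun x => (g.continuous.tendsto _).comp (hγ x))

theorem IsRIMSection.range_nullMeasurableSet_and_measure_eq_one (htame : IsTame Γ X)
    (hπ : IsHomomorphism Γ π) (hν : IsRIMSection Γ π ν) {p : X → X}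
    (hp : p ∈ envelopingSemigroup Γ X) (y : Y) :
    NullMeasurableSet (range p) (ν (hπ.factorMap p y) : Measure X) ∧
      (ν (hπ.factorMap p y) : Measure X) (range p) = 1 := by
  let := TopologicalSpace.metrizableSpaceMetric X
  obtain ⟨γ, hγ⟩ := htame.exists_seq_tendsto hp
  obtain ⟨A, hAp, hA, hA0⟩ := exists_measurableSet_subset_range_of_tendsto (ν y : Measure X)
    (f := fun n x => γ n • x) (fun n => continuous_const_smul (γ n)) hγ
  rw [hν.map_eq htame hπ hp] at hA0
  have hae : range p =ᵐ[(ν (hπ.factorMap p y) : Measure X)] univ :=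
    eventuallyEq_univ.2 (mem_of_superset (mem_ae_iff.2 hA0) hAp)
  exact ⟨nullMeasurableSet_univ.congr hae.symm, by rw [measure_congr hae, measure_univ]⟩

omit [CompactSpace X] [TopologicalSpace.MetrizableSpace X] [ContinuousConstSMul Γ X] in
theorem IsRIMSection.support_subset (hπ : IsHomomorphism Γ π) (hν : IsRIMSection Γ π ν) (y : Y) :
    (ν y : Measure X).support ⊆ π ⁻¹' {y} := by
  refine Measure.support_subset_of_isClosed (isClosed_singleton.preimage hπ.continuous) ?_
  rw [mem_ae_iff, ← preimage_compl, ← Measure.map_apply hπ.continuous.measurable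
    isClosed_singleton.isOpen_compl.measurableSet, hν.map_eq_dirac,
    Measure.dirac_apply' _ isClosed_singleton.isOpen_compl.measurableSet]
  simp

omit [CompactSpace X] [TopologicalSpace.MetrizableSpace X] [T2Space Y] in
theorem IsRIMSection.smul_mem_support (hν : IsRIMSection Γ π ν) (γ : Γ) {y : Y} {x : X}
    (hx : x ∈ (ν y : Measure X).support) : γ • x ∈ (ν (γ • y) : Measure X).support := by
  rw [Measure.mem_support_iff_forall] at hx ⊢
  intro U hU
  rw [hν.equivariant]
  exact (hx _ ((continuous_const_smul γ).continuousAt hU)).trans_le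
    (Measure.le_map_apply (continuous_const_smul γ).measurable.aemeasurable U)

omit [T2Space Y] in
-- By equivariance the union contains the orbit of any of its points, and orbits are dense.
theorem IsRIMSection.dense_iUnion_support [MulAction.IsMinimal Γ X] [Nonempty Y]
    (hν : IsRIMSection Γ π ν) : Dense (⋃ y, (ν y : Measure X).support) := by
  let := TopologicalSpace.metrizableSpaceMetric X
  obtain ⟨y⟩ := ‹Nonempty Y›
  obtain ⟨x, hx⟩ := Measure.nonempty_support (μ := (ν y : Measure X))
    (IsProbabilityMeasure.ne_zero _)
  refine (MulAction.dense_orbit Γ x).mono ?_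
  rintro _ ⟨γ, rfl⟩
  exact mem_iUnion.2 ⟨γ • y, hν.smul_mem_support γ hx⟩

omit [ContinuousConstSMul Γ X] [T2Space Y] in
theorem IsRIMSection.isOpen_support_inter_nonempty (hν : IsRIMSection Γ π ν) (U : Set X)
    (hU : IsOpen U) : IsOpen {y | ((ν y : Measure X).support ∩ U).Nonempty} := by
  let := TopologicalSpace.metrizableSpaceMetric X
  exact isOpen_setOf_support_inter_nonempty hν.continuous hU

/-- If `x` in the fibre were off the support, upper semicontinuity at `y` would keep the supports
over points near `π x` away from `x`. But points lying in the support over their own image are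
dense, hence occur near `x`. -/
theorem IsRIMSection.support_eq_fiber [MulAction.IsMinimal Γ X] (hπ : IsHomomorphism Γ π)
    (hν : IsRIMSection Γ π ν) {y : Y} (hy : y ∈ fullSupportPoints ν) :
    (ν y : Measure X).support = π ⁻¹' {y} := by
  let := TopologicalSpace.metrizableSpaceMetric X
  have : Nonempty Y := ⟨y⟩
  refine (hν.support_subset hπ y).antisymm fun x hx => ?_
  by_contra hxs
  have husc := (continuousAt_vietoris_iff hν.isOpen_support_inter_nonempty y).1 hy
  obtain ⟨U, W, hU, hW, hSU, hxW, hdisj⟩ := normal_separation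
    Measure.isClosed_support (isClosed_singleton (x := x)) (disjoint_singleton_right.2 hxs)
  have hx' : π x = y := hx
  have hN : ∀ᶠ x' in 𝓝 x, (ν (π x') : Measure X).support ⊆ U :=
    (hπ.continuous.tendsto x).eventually (by rw [hx']; exact husc U hU hSU)
  obtain ⟨x', ⟨hx'U, hx'W⟩, hx's⟩ := mem_closure_iff_nhds.1 (hν.dense_iUnion_support x) _
    (hN.and (hW.mem_nhds (hxW rfl)))
  obtain ⟨z, hz⟩ := mem_iUnion.1 hx's
  have hzx : π x' = z := hν.support_subset hπ z hz
  exact disjoint_left.1 hdisj (hx'U (by rw [hzx]; exact hz)) hx'W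

end Rim

end TopDyn

theorem lemma4p2 {Γ X Y : Type*} [Group Γ]
    [TopologicalSpace X] [CompactSpace X] [TopologicalSpace.MetrizableSpace X] [Nonempty X]
    [MeasurableSpace X] [BorelSpace X] [MulAction Γ X] [ContinuousConstSMul Γ X]
    [TopologicalSpace Y] [CompactSpace Y] [T2Space Y]
    [MeasurableSpace Y] [BorelSpace Y] [MulAction Γ Y] [ContinuousConstSMul Γ Y]
    (htame : TopDyn.IsTame Γ X) (hprox : TopDyn.IsProximal Γ Y)
    (π : X → Y) (hπ : TopDyn.IsHomomorphism Γ π)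
    (ν : Y → ProbabilityMeasure X) (hν : TopDyn.IsRIMSection Γ π ν) :
    (∀ p ∈ TopDyn.envelopingSemigroup Γ X, Measurable p ∧ ∀ y : Y,
      (ν y : Measure X).map p = (ν (hπ.factorMap p y) : Measure X) ∧
      NullMeasurableSet (range p) (ν (hπ.factorMap p y) : Measure X) ∧
      (ν (hπ.factorMap p y) : Measure X) (range p) = 1) ∧
    (∀ v : X → X, TopDyn.IsMinimalIdempotent Γ v →
      (∃! y : Y, hπ.factorMap v y = y) ∧
      ∀ y : Y, hπ.factorMap v y = y →
        range v ⊆ π ⁻¹' {y} ∧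
        (ν y : Measure X) (range v) = 1 ∧
        (ν y : Measure X).support ⊆ closure (range v ∩ π ⁻¹' {y}) ∧
        range v ∩ π ⁻¹' {y} = v '' (π ⁻¹' {y})) ∧
    (∀ v : X → X, TopDyn.IsIdempotent Γ v → TopDyn.idemContPoints v ⊆ range v) ∧
    (MulAction.IsMinimal Γ X →
      Dense (TopDyn.fullSupportPoints ν) ∧ IsGδ (TopDyn.fullSupportPoints ν) ∧
      (∀ y ∈ TopDyn.fullSupportPoints ν, (ν y : Measure X).support = π ⁻¹' {y}) ∧
      ∀ y : Y, (ν y : Measure X).support = π ⁻¹' {y} →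
        ∀ v : X → X, TopDyn.IsMinimalIdempotent Γ v → hπ.factorMap v y = y →
          TopDyn.idemContPoints v ⊆ π ⁻¹' {y} ∧
          Dense ((↑) ⁻¹' TopDyn.idemContPoints v : Set (π ⁻¹' {y})) ∧
          IsGδ ((↑) ⁻¹' TopDyn.idemContPoints v : Set (π ⁻¹' {y})) ∧
          range v ⊆ π ⁻¹' {y} ∧
          ((↑) ⁻¹' range v : Set (π ⁻¹' {y})) ∈ residual (π ⁻¹' {y})) := by
  have hrange : ∀ v : X → X, TopDyn.IsMinimalIdempotent Γ v → ∀ y : Y, hπ.factorMap v y = y →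
      range v ⊆ π ⁻¹' {y} := by
    rintro v hv y hy _ ⟨x, rfl⟩
    rw [mem_preimage, mem_singleton_iff, ← hπ.factorMap_apply hv.1.1,
      hv.factorMap_eq hπ hprox (π x) y, hy]
  have hone : ∀ v : X → X, TopDyn.IsMinimalIdempotent Γ v → ∀ y : Y, hπ.factorMap v y = y →
      (ν y : Measure X) (range v) = 1 := by
    intro v hv y hy
    have := (hν.range_nullMeasurableSet_and_measure_eq_one htame hπ hv.1.1 y).2
    rwa [hy] at this
  have hsupp : ∀ v : X → X, TopDyn.IsMinimalIdempotent Γ v → ∀ y : Y, hπ.factorMap v y = y →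
      (ν y : Measure X).support ⊆ closure (range v) := by
    intro v hv y hy
    refine Measure.support_subset_of_isClosed isClosed_closure ?_
    refine (mem_ae_iff_prob_eq_one isClosed_closure.measurableSet).2 (le_antisymm prob_le_one ?_)
    rw [← hone v hv y hy]
    exact measure_mono subset_closure
  refine ⟨fun p hp => ⟨htame.measurable hp, fun y => ⟨hν.map_eq htame hπ hp y,
    hν.range_nullMeasurableSet_and_measure_eq_one htame hπ hp y⟩⟩, fun v hv => ⟨?_, ?_⟩,
    fun v hv => TopDyn.idemContPoints_subset_range hv.2, fun hmin => ?_⟩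
  · obtain ⟨x⟩ := ‹Nonempty X›
    exact ⟨hπ.factorMap v (π x), hv.factorMap_eq hπ hprox _ _, fun y hy => by
      rw [← hy]
      exact hv.factorMap_eq hπ hprox _ _⟩
  · intro y hy
    have hr := hrange v hv y hy
    rw [inter_eq_left.2 hr]
    refine ⟨hr, hone v hv y hy, hsupp v hv y hy, Subset.antisymm ?_ (image_subset_range _ _)⟩
    rintro _ ⟨x, rfl⟩
    exact ⟨v x, hr ⟨x, rfl⟩, congrFun hv.1.2 x⟩
  · obtain ⟨hd, hG⟩ := TopDyn.dense_isGδ_continuousAt_vietoris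
      (S := fun y => (ν y : Measure X).support) (fun y => Measure.isClosed_support)
      hν.isOpen_support_inter_nonempty
    refine ⟨hd, hG, fun y hy => hν.support_eq_fiber hπ hy, fun y hy v hv hvy => ?_⟩
    have hr := hrange v hv y hvy
    -- The closed set `closure (range v)` is conull, so it contains the support, here the whole
    -- fibre.
    have hcl : closure (range v) = π ⁻¹' {y} :=
      (closure_minimal hr (isClosed_singleton.preimage hπ.continuous)).antisymm
        (hy ▸ hsupp v hv y hvy)
    obtain ⟨γ, hγ⟩ := htame.exists_seq_tendsto hv.1.1
    have hC := TopDyn.dense_isGδ_contPoints (isClosed_singleton.preimage hπ.continuous)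
      (A := π ⁻¹' {y}) (f := fun n x => γ n • x) (fun n => continuous_const_smul (γ n)) hγ
    have heq : TopDyn.idemContPoints v = TopDyn.contPoints (π ⁻¹' {y}) v := by
      rw [TopDyn.idemContPoints, hcl]
    rw [← heq] at hC
    exact ⟨heq ▸ fun x hx => hx.1, hC.1, hC.2, hr,
      mem_of_superset (residual_of_dense_Gδ hC.2 hC.1)
        (preimage_mono (TopDyn.idemContPoints_subset_range hv.1.2))⟩
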